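/- Let $n\ge 3$ and let $K_n$ be the complete graph on $n$ vertices. Let $F_{K_n}=\sum_{T}\prod_{e\in E(T)}x_e$ be its Kirchhoff polynomial, where $T$ runs over the spanning trees of $K_n$ and there is one variable $x_e$ for each edge $e$ of $K_n$. Let $$\tilde H_{K_n}=\left(\frac{\partial^2 F_{K_n}}{\partial x_i\,\partial x_j}\Big|_{x_e=1\text{ for all }e}\right)_{i,j\in E(K_n)},$$ a real $\binom n2\times\binom n2$ matrix. Then the eigenspaces of $\tilde H_{K_n}$ for $$-2n^{n-4},\qquad -n^{n-3},\qquad 2(n-2)n^{n-3}$$ have dimensions $\binom n2-n$, $n-1$ and $1$, respectively, and $\tilde H_{K_n}$ has no other eigenvalues. (For $n\ge 4$ all three numbers are eigenvalues; for $n=3$ the first dimension is $0$, so that only $-n^{n-3}=-1$ and $2(n-2)n^{n-3}=2$ are eigenvalues.) Consequently the symmetric matrix $\tilde H_{K_n}$ has Lorentzian signature: of its $\binom n2$ eigenvalues, counted with multiplicity, exactly one is positive and all the others are negative. -/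

import Mathlib

namespace SimpleGraph

noncomputable section

variable {V : Type*} [Fintype V]

/-- The finite set of spanning trees of `G`. A spanning tree has the same vertex set `V` as `G`, so
it is a simple graph on `V` that is a tree and all of whose edges are edges of `G`. -/
def spanningTrees (G : SimpleGraph V) : Finset (SimpleGraph V) :=
  (Set.toFinite {T : SimpleGraph V | T ≤ G ∧ T.IsTree}).toFinset

open Classical in
/-- The Kirchhoff polynomial `∑_T ∏_{e ∈ E(T)} x_e`, with `T` running over the spanning trees of
`G`, in one variable `x_e` for each edge `e` of `G`. -/
def kirchhoffPolynomial (R : Type*) [CommRing R] (G : SimpleGraph V) : MvPolynomial G.edgeSet R :=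
  ∑ T ∈ G.spanningTrees, ∏ e : G.edgeSet with e.1 ∈ T.edgeSet, MvPolynomial.X e

/-- The Hessian matrix of `G`: the matrix of second partial derivatives of its Kirchhoff
polynomial, with rows and columns indexed by the edges of `G`. -/
def hessianMatrix (R : Type*) [CommRing R] (G : SimpleGraph V) :
    Matrix G.edgeSet G.edgeSet (MvPolynomial G.edgeSet R) :=
  Matrix.of fun i j =>
    MvPolynomial.pderiv i (MvPolynomial.pderiv j (G.kirchhoffPolynomial R))

/-- The Hessian matrix of `G` with all the variables evaluated at `1`. -/
def hessianMatrixAtOne (R : Type*) [CommRing R] (G : SimpleGraph V) :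
    Matrix G.edgeSet G.edgeSet R :=
  (G.hessianMatrix R).map (MvPolynomial.eval fun _ => 1)

end

end SimpleGraph

/-! ### Counting the trees that contain a given forest -/

namespace SimpleGraph

open Finset
open scoped Classical

noncomputable section

variable {V : Type*}

/-! Off the diagonal, the Hessian at 1 counts the spanning trees through two given edges. A forest
with `k` components of sizes `c₁, …, c_k` lies in `n^(k-2) ∏ cᵢ` trees
(`IsForestLabelling.numTreesAbove_mul_sq`). Two distinct edges thus give `4n^(n-4)` if disjoint and
`3n^(n-4)` if they share a vertex. With `c = n^(n-4)`, `J` the all-ones matrix and `M` the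
edge-vertex incidence matrix, this reads `H = c(4J - 2I - MMᵀ)` (`hessianMatrixAtOne_top_apply`),
while `MᵀM = (n-2)I + J`. Eigenvectors are now visible: the kernel of `Mᵀ`, the image under `M` of
the sum-zero vectors, and the constants. The resulting lower bounds on dimensions already add up to
`n.choose 2`, so they are equalities and no other eigenvalue fits
(`roots_charpoly_eq_of_le_finrank`). -/

/-- Merge the label class of `v` into that of `u`. -/
def mergeLabel (f : V → V) (u v : V) : V → V := fun x => if f x = f v then f u else f x

lemma mergeLabel_eq_iff {f : V → V} {u v : V} (x y : V) :
    mergeLabel f u v x = mergeLabel f u v y ↔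
      f x = f y ∨ ((f x = f u ∨ f x = f v) ∧ (f y = f u ∨ f y = f v)) := by
  unfold mergeLabel
  grind

/-- Same shape as `mergeLabel_eq_iff`, so labels keep in step with components when an edge is added.
-/
lemma reachable_sup_edge_iff {F : SimpleGraph V} {u v : V} (x y : V) :
    (F ⊔ edge u v).Reachable x y ↔ F.Reachable x y ∨
      ((F.Reachable x u ∨ F.Reachable x v) ∧ (F.Reachable y u ∨ F.Reachable y v)) := by
  constructor
  · rintro ⟨w⟩
    induction w with
    | nil => exact .inl .rfl
    | @cons a b c hab _ ih =>
      rw [sup_adj, edge_adj] at hab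
      rcases hab with hab | ⟨⟨rfl, rfl⟩ | ⟨rfl, rfl⟩, -⟩
      · rcases ih with h | ⟨h | h, h'⟩
        · exact .inl (hab.reachable.trans h)
        · exact .inr ⟨.inl (hab.reachable.trans h), h'⟩
        · exact .inr ⟨.inr (hab.reachable.trans h), h'⟩
      · rcases ih with h | ⟨-, h'⟩
        · exact .inr ⟨.inl .rfl, .inr h.symm⟩
        · exact .inr ⟨.inl .rfl, h'⟩
      · rcases ih with h | ⟨-, h'⟩
        · exact .inr ⟨.inr .rfl, .inl h.symm⟩
        · exact .inr ⟨.inr .rfl, h'⟩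
  · have huv : (F ⊔ edge u v).Reachable u v := by
      by_cases h : u = v
      · rw [h]
      · exact Adj.reachable (by simp [edge_adj, h])
    have hm : ∀ {a b}, F.Reachable a b → (F ⊔ edge u v).Reachable a b :=
      fun h => h.mono le_sup_left
    rintro (h | ⟨h | h, h' | h'⟩)
    · exact hm h
    · exact (hm h).trans (hm h').symm
    · exact ((hm h).trans huv).trans (hm h').symm
    · exact ((hm h).trans huv.symm).trans (hm h').symm
    · exact (hm h).trans (hm h').symm

variable [Fintype V]

/-- The number of vertices that carry the same label as `x`. -/
def labelCard (f : V → V) (x : V) : ℕ := #{y | f y = f x}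

/-- The product of the sizes of the label classes. -/
def labelWeight (f : V → V) : ℕ := ∏ i ∈ univ.image f, #{y | f y = i}

/-- `F` is a forest whose connected components are the label classes of `f`. -/
structure IsForestLabelling (F : SimpleGraph V) (f : V → V) : Prop where
  isAcyclic : F.IsAcyclic
  reachable_iff : ∀ u v, F.Reachable u v ↔ f u = f v
  card_edges : #F.edgeFinset + #(univ.image f) = Fintype.card V

lemma labelCard_pos (f : V → V) (x : V) : 0 < labelCard f x :=
  card_pos.2 ⟨x, by simp⟩

lemma image_mergeLabel {f : V → V} {u v : V} (h : f u ≠ f v) :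
    univ.image (mergeLabel f u v) = (univ.image f).erase (f v) := by
  ext i
  simp only [mem_image, mem_univ, true_and, mem_erase, mergeLabel]
  grind

/-- Merging replaces two factors `a`, `b` of the product by `a + b`; cross-multiplied to stay in
`ℕ`. -/
lemma labelWeight_mergeLabel {f : V → V} {u v : V} (h : f u ≠ f v) :
    labelWeight (mergeLabel f u v) * (labelCard f u * labelCard f v) =
      labelWeight f * (labelCard f u + labelCard f v) := by
  have hv : f v ∈ univ.image f := by simp
  have hu : f u ∈ (univ.image f).erase (f v) := by simp [h]
  have h1 : #{y | mergeLabel f u v y = f u} = labelCard f u + labelCard f v := by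
    unfold labelCard
    rw [← card_union_of_disjoint]
    · congr 1
      ext y
      simp only [mem_filter, mem_univ, true_and, mem_union, mergeLabel]
      grind
    · rw [disjoint_filter]
      grind
  have h2 : ∀ i ∈ ((univ.image f).erase (f v)).erase (f u),
      #{y | mergeLabel f u v y = i} = #{y | f y = i} := by
    intro i hi
    simp only [mem_erase] at hi
    congr 1
    ext y
    simp only [mem_filter, mem_univ, true_and, mergeLabel]
    grind
  rw [labelWeight, labelWeight, image_mergeLabel h, ← mul_prod_erase _ _ hu,
    ← mul_prod_erase _ _ hv, ← mul_prod_erase _ _ hu, h1, prod_congr rfl h2]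
  simp only [labelCard]
  ring

lemma isForestLabelling_bot : IsForestLabelling (⊥ : SimpleGraph V) id where
  isAcyclic := isAcyclic_bot
  reachable_iff u v := by simp
  card_edges := by simp

lemma IsForestLabelling.sup_edge {F : SimpleGraph V} {f : V → V} (h : IsForestLabelling F f)
    {u v : V} (huv : f u ≠ f v) : IsForestLabelling (F ⊔ edge u v) (mergeLabel f u v) where
  isAcyclic := h.isAcyclic.sup_edge_of_not_reachable (by rwa [h.reachable_iff])
  reachable_iff x y := by
    simp only [reachable_sup_edge_iff, mergeLabel_eq_iff, h.reachable_iff]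
  card_edges := by
    have hadj : ¬F.Adj u v := fun hadj => huv ((h.reachable_iff u v).1 hadj.reachable)
    have hne : u ≠ v := fun e => huv (congrArg f e)
    have h2 : f v ∈ univ.image f := by simp
    have h3 := card_pos.2 ⟨_, h2⟩
    calc
      _ = (#F.edgeFinset + 1) + (#(univ.image f) - 1) := by
        rw [image_mergeLabel huv, card_erase_of_mem h2]
        congr 1
        convert F.card_edgeFinset_sup_edge hadj hne
      _ = Fintype.card V := by
        have := h.card_edges
        omega

lemma card_adj_pairs (G : SimpleGraph V) :
    #{p : V × V | G.Adj p.1 p.2} = 2 * #G.edgeFinset := by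
  rw [← sum_degrees_eq_twice_card_edges, card_filter, Fintype.sum_prod_type]
  refine sum_congr rfl fun u _ => ?_
  rw [← card_filter, ← card_neighborFinset_eq_degree]
  congr 1
  ext v
  simp

/-- The number of trees on `V` that contain `F`. -/
def numTreesAbove (F : SimpleGraph V) : ℕ := #{T : SimpleGraph V | T.IsTree ∧ F ≤ T}

/-- Every edge of a tree is a bridge, so an edge of `T` inside a component of `F` already belongs to
`F`. The edges across components are thus the remaining `k - 1`, each seen as two ordered pairs. -/
lemma IsForestLabelling.card_pairs_sdiff {F T : SimpleGraph V} {f : V → V}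
    (h : IsForestLabelling F f) (hT : T.IsTree) (hF : F ≤ T) :
    #{p : V × V | T.Adj p.1 p.2 ∧ f p.1 ≠ f p.2} + 2 = 2 * #(univ.image f) := by
  have h1 : ({p : V × V | T.Adj p.1 p.2 ∧ f p.1 ≠ f p.2} : Finset _) =
      ({p : V × V | T.Adj p.1 p.2} : Finset _) \ ({p : V × V | F.Adj p.1 p.2} : Finset _) := by
    ext ⟨u, v⟩
    simp only [mem_filter, mem_univ, true_and, mem_sdiff, and_congr_right_iff]
    rw [ne_eq, ← h.reachable_iff]
    refine fun hadj => not_congr ⟨fun hr => ?_, fun hr => hr.reachable⟩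
    by_contra hn
    have hb := isAcyclic_iff_forall_adj_isBridge.1 hT.isAcyclic hadj
    rw [isBridge_iff] at hb
    refine hb (hr.mono fun a b hab => ?_)
    rw [deleteEdges_adj]
    refine ⟨hF hab, fun he => hn ?_⟩
    rw [Set.mem_singleton_iff] at he
    rw [← mem_edgeSet] at hab ⊢
    rwa [← he]
  rw [h1, card_sdiff_of_subset (by intro p; simpa using fun hp => hF hp), card_adj_pairs,
    card_adj_pairs]
  have h2 := hT.card_edgeFinset
  have h3 := h.card_edges
  have h4 : #F.edgeFinset ≤ #T.edgeFinset := card_le_card (edgeFinset_mono hF)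
  omega

lemma sum_inv_labelCard (f : V → V) :
    ∑ x, (labelCard f x : ℚ)⁻¹ = #(univ.image f) := by
  rw [← sum_fiberwise_of_maps_to (g := f) (t := univ.image f) (by simp), card_eq_sum_ones,
    Nat.cast_sum]
  refine sum_congr rfl fun i hi => ?_
  obtain ⟨x, -, rfl⟩ := mem_image.1 hi
  have h : ∀ y ∈ ({y | f y = f x} : Finset V), (labelCard f y : ℚ)⁻¹ = (labelCard f x : ℚ)⁻¹ := by
    intro y hy
    rw [mem_filter] at hy
    rw [labelCard, labelCard, hy.2]
  rw [sum_congr rfl h, sum_const, nsmul_eq_mul, ← labelCard, Nat.cast_one]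
  exact mul_inv_cancel₀ (by exact_mod_cast (labelCard_pos f x).ne')

lemma card_label_ne (f : V → V) (u : V) :
    (#{v | f u ≠ f v} : ℚ) = Fintype.card V - labelCard f u := by
  have h := card_filter_add_card_filter_not (s := (univ : Finset V)) (fun v => f v = f u)
  rw [card_univ] at h
  simp only [labelCard, ← h, ne_comm, ne_eq]
  push_cast
  simp

/-- If `u` has class size `ℓ`, its `n - ℓ` partners contribute `(n - ℓ)/ℓ = n/ℓ - 1`; since each
class has total `∑ 1/ℓ = 1`, the sum over `u` is `nk - n`. The other summand is symmetric. -/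
lemma sum_pairs_inv_labelCard (f : V → V) :
    ∑ p : V × V with f p.1 ≠ f p.2, ((labelCard f p.1 : ℚ)⁻¹ + (labelCard f p.2 : ℚ)⁻¹) =
      2 * Fintype.card V * (#(univ.image f) - 1) := by
  have h1 : ∑ u, ∑ v, (if f u ≠ f v then (labelCard f u : ℚ)⁻¹ else 0) =
      Fintype.card V * (#(univ.image f) - 1) := by
    have : ∀ u, ∑ v, (if f u ≠ f v then (labelCard f u : ℚ)⁻¹ else 0) =
        Fintype.card V * (labelCard f u : ℚ)⁻¹ - 1 := by
      intro u
      have hpos : (labelCard f u : ℚ) ≠ 0 := by exact_mod_cast (labelCard_pos f u).ne'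
      rw [← sum_filter, sum_const, nsmul_eq_mul, card_label_ne, sub_mul, mul_inv_cancel₀ hpos]
    simp only [this, sum_sub_distrib, ← mul_sum, sum_inv_labelCard]
    simp
    ring
  have h2 : ∑ u, ∑ v, (if f u ≠ f v then (labelCard f v : ℚ)⁻¹ else 0) =
      Fintype.card V * (#(univ.image f) - 1) := by
    rw [sum_comm, ← h1]
    simp only [ne_comm]
  rw [sum_filter, Fintype.sum_prod_type]
  simp only [ite_add_zero, sum_add_distrib, h1, h2]
  ring

/-- The number of spanning trees of the complete graph that contain a given forest. -/
theorem IsForestLabelling.numTreesAbove_mul_sq [Nonempty V] {F : SimpleGraph V} {f : V → V}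
    (h : IsForestLabelling F f) :
    numTreesAbove F * Fintype.card V ^ 2 = Fintype.card V ^ #(univ.image f) * labelWeight f := by
  obtain ⟨k, hk⟩ : ∃ k, #(univ.image f) = k + 1 :=
    Nat.exists_eq_succ_of_ne_zero (card_pos.2 (univ_nonempty.image f)).ne'
  induction k generalizing F f with
  | zero =>
    -- One component: `F` is the only tree above itself, and both sides equal `n²`.
    have hfc : ∀ x y, f x = f y := fun x y =>
      card_le_one.1 hk.le _ (mem_image_of_mem f (mem_univ x)) _ (mem_image_of_mem f (mem_univ y))
    have hF : F.IsTree := ⟨⟨fun x y => (h.reachable_iff x y).2 (hfc x y)⟩, h.isAcyclic⟩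
    have h1 : numTreesAbove F = 1 := by
      rw [numTreesAbove, card_eq_one]
      refine ⟨F, ?_⟩
      ext T
      simp only [mem_filter, mem_univ, true_and, mem_singleton]
      refine ⟨fun hT => ?_, fun hT => hT.symm ▸ ⟨hF, le_rfl⟩⟩
      exact ((isTree_iff_minimal_connected.1 hT.1).eq_of_le hF.connected hT.2).symm
    obtain ⟨x⟩ := ‹Nonempty V›
    have h2 : univ.image f = {f x} := by
      ext i
      simp only [mem_image, mem_univ, true_and, mem_singleton]
      exact ⟨fun ⟨y, hy⟩ => hy ▸ hfc y x, fun hi => ⟨x, hi.symm⟩⟩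
    rw [h1, labelWeight, h2]
    simp [hfc _ x, sq]
  | succ k ih =>
    -- Double count pairs of a tree above `F` and an ordered edge of it joining two components: each
    -- tree has `2(k + 1)` of these, as there are `k + 2` components.
    have h1 : ∑ p : V × V with f p.1 ≠ f p.2, numTreesAbove (F ⊔ edge p.1 p.2) =
        numTreesAbove F * (2 * (k + 1)) := by
      have : ∀ p ∈ ({p : V × V | f p.1 ≠ f p.2} : Finset _),
          numTreesAbove (F ⊔ edge p.1 p.2) =
            #{T ∈ ({T : SimpleGraph V | T.IsTree ∧ F ≤ T} : Finset _) | T.Adj p.1 p.2} := by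
        intro p hp
        rw [mem_filter] at hp
        have hne : p.1 ≠ p.2 := fun e => hp.2 (congrArg f e)
        rw [numTreesAbove, filter_filter]
        congr 1
        ext T
        simp only [mem_filter, mem_univ, true_and, sup_le_iff, and_assoc, edge_le_iff, hne,
          false_or]
      have hcomm := sum_card_bipartiteAbove_eq_sum_card_bipartiteBelow
        (s := ({p : V × V | f p.1 ≠ f p.2} : Finset _))
        (t := ({T : SimpleGraph V | T.IsTree ∧ F ≤ T} : Finset _))
        (fun (p : V × V) (T : SimpleGraph V) => T.Adj p.1 p.2)
      simp only [bipartiteAbove] at hcomm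
      rw [sum_congr rfl this, hcomm, numTreesAbove, ← smul_eq_mul, ← sum_const]
      refine sum_congr rfl fun T hT => ?_
      simp only [mem_filter, mem_univ, true_and] at hT
      have := h.card_pairs_sdiff hT.1 hT.2
      rw [bipartiteBelow, filter_filter]
      simp only [and_comm] at this ⊢
      omega
    have h2 : ∀ p ∈ ({p : V × V | f p.1 ≠ f p.2} : Finset _),
        (numTreesAbove (F ⊔ edge p.1 p.2) : ℚ) * Fintype.card V ^ 2 =
          Fintype.card V ^ (k + 1) * labelWeight f *
            ((labelCard f p.1 : ℚ)⁻¹ + (labelCard f p.2 : ℚ)⁻¹) := by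
      intro p hp
      simp only [mem_filter, mem_univ, true_and] at hp
      have hc : #(univ.image (mergeLabel f p.1 p.2)) = k + 1 := by
        rw [image_mergeLabel hp, card_erase_of_mem (by simp), hk]
        rfl
      have h3 := ih (h.sup_edge hp) hc
      rw [hc] at h3
      have h4 := labelWeight_mergeLabel hp
      have h5 : (labelCard f p.1 : ℚ) ≠ 0 := by exact_mod_cast (labelCard_pos f _).ne'
      have h6 : (labelCard f p.2 : ℚ) ≠ 0 := by exact_mod_cast (labelCard_pos f _).ne'
      have h3' : (numTreesAbove (F ⊔ edge p.1 p.2) : ℚ) * Fintype.card V ^ 2 =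
          Fintype.card V ^ (k + 1) * labelWeight (mergeLabel f p.1 p.2) := by exact_mod_cast h3
      have h4' : (labelWeight (mergeLabel f p.1 p.2) : ℚ) * (labelCard f p.1 * labelCard f p.2) =
          labelWeight f * (labelCard f p.1 + labelCard f p.2) := by exact_mod_cast h4
      have h7 : (labelWeight (mergeLabel f p.1 p.2) : ℚ) = labelWeight f *
            ((labelCard f p.1 : ℚ)⁻¹ + (labelCard f p.2 : ℚ)⁻¹) := by
        field_simp
        linear_combination h4'
      rw [h3', h7, mul_assoc]
    have h3 := sum_congr rfl h2
    rw [← sum_mul, ← mul_sum, sum_pairs_inv_labelCard, hk, ← Nat.cast_sum, h1] at h3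
    have hpos : (2 * ((k : ℚ) + 1)) ≠ 0 := by positivity
    rw [hk]
    suffices ((numTreesAbove F : ℚ) * Fintype.card V ^ 2) =
        Fintype.card V ^ (k + 1 + 1) * labelWeight f by exact_mod_cast this
    apply mul_left_cancel₀ hpos
    push_cast at h3
    linear_combination h3

end

end SimpleGraph

/-! ### Entries of the Hessian at 1 -/

namespace SimpleGraph

open Finset
open scoped Classical

noncomputable section

lemma pderiv_prod_X {σ R : Type*} [CommRing R] (i : σ) (s : Finset σ) :
    MvPolynomial.pderiv i (∏ e ∈ s, (MvPolynomial.X e : MvPolynomial σ R)) =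
      if i ∈ s then ∏ e ∈ s.erase i, MvPolynomial.X e else 0 := by
  have h0 : ∀ t : Finset σ, i ∉ t →
      MvPolynomial.pderiv i (∏ e ∈ t, (MvPolynomial.X e : MvPolynomial σ R)) = 0 := by
    intro t
    induction t using Finset.induction_on with
    | empty => simp
    | insert a t ha ih =>
      intro hi
      rw [mem_insert, not_or] at hi
      rw [prod_insert ha, Derivation.leibniz, ih hi.2,
        MvPolynomial.pderiv_X_of_ne (Ne.symm hi.1)]
      simp
  split_ifs with hi
  · rw [← mul_prod_erase s _ hi, Derivation.leibniz, h0 _ (notMem_erase i s),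
      MvPolynomial.pderiv_X_self]
    simp
  · exact h0 s hi

lemma eval_one_pderiv_pderiv_prod_X {σ R : Type*} [CommRing R] (i j : σ) (s : Finset σ) :
    MvPolynomial.eval (fun _ => (1 : R)) (MvPolynomial.pderiv i (MvPolynomial.pderiv j
      (∏ e ∈ s, MvPolynomial.X e))) =
      if i = j then 0 else if i ∈ s ∧ j ∈ s then 1 else 0 := by
  by_cases hj : j ∈ s <;> by_cases hi : i ∈ s <;> by_cases hij : i = j <;>
    simp [hj, hi, hij, pderiv_prod_X]

variable {V : Type*} [Fintype V]

lemma hessianMatrixAtOne_apply (R : Type*) [CommRing R] (G : SimpleGraph V) (i j : G.edgeSet) :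
    G.hessianMatrixAtOne R i j = if i = j then 0 else
      (#{T ∈ G.spanningTrees | i.1 ∈ T.edgeSet ∧ j.1 ∈ T.edgeSet} : R) := by
  simp only [hessianMatrixAtOne, hessianMatrix, Matrix.map_apply, Matrix.of_apply,
    kirchhoffPolynomial, map_sum, eval_one_pderiv_pderiv_prod_X, mem_filter, mem_univ, true_and]
  split_ifs with hij
  · simp
  · rw [sum_boole]

lemma labelWeight_id : labelWeight (id : V → V) = 1 := by
  exact prod_eq_one fun i _ => card_eq_one.2 ⟨i, by ext; simp⟩

lemma labelCard_id (x : V) : labelCard id x = 1 := by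
  exact card_eq_one.2 ⟨x, by ext; simp⟩

lemma labelCard_mergeLabel_id {a b : V} (hab : a ≠ b) (x : V) :
    labelCard (mergeLabel id a b) x = if x = a ∨ x = b then 2 else 1 := by
  split_ifs with hx
  · rw [labelCard, ← card_pair hab]
    congr 1
    ext y
    simp only [mem_filter, mem_univ, true_and, mergeLabel_eq_iff, mem_insert, mem_singleton, id]
    grind
  · rw [labelCard, card_eq_one]
    refine ⟨x, ?_⟩
    ext y
    simp only [mem_filter, mem_univ, true_and, mergeLabel_eq_iff, mem_singleton, id]
    grind

/-- The number of spanning trees of the complete graph through two given edges. -/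
lemma card_spanningTrees_top_two_edges {i j : Sym2 V} (hi : ¬i.IsDiag) (hj : ¬j.IsDiag)
    (hij : i ≠ j) :
    #{T ∈ (⊤ : SimpleGraph V).spanningTrees | i ∈ T.edgeSet ∧ j ∈ T.edgeSet} *
        Fintype.card V ^ 2 + Fintype.card V ^ (Fintype.card V - 2) * #{x | x ∈ i ∧ x ∈ j} =
      Fintype.card V ^ (Fintype.card V - 2) * 4 := by
  induction i with | _ a b
  induction j with | _ c d
  rw [Sym2.mk_isDiag_iff] at hi hj
  have : Nonempty V := ⟨a⟩
  have h1 : (id a : V) ≠ id b := hi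
  -- Distinct edges of a simple graph form no cycle, so the second edge still joins two components.
  have h2 : mergeLabel id a b c ≠ mergeLabel id a b d := by
    rw [ne_eq, mergeLabel_eq_iff]
    simp only [id, ne_eq, Sym2.eq_iff] at hij ⊢
    grind
  have hF := (isForestLabelling_bot.sup_edge h1).sup_edge h2
  have hw1 := labelWeight_mergeLabel h1
  have hw2 := labelWeight_mergeLabel h2
  have hN := hF.numTreesAbove_mul_sq
  have hk : #(univ.image (mergeLabel (mergeLabel id a b) c d)) = Fintype.card V - 2 := by
    rw [image_mergeLabel h2, card_erase_of_mem (by simp), image_mergeLabel h1,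
      card_erase_of_mem (by simp)]
    simp
    omega
  rw [hk] at hN
  have hcard : #{T ∈ (⊤ : SimpleGraph V).spanningTrees |
      s(a, b) ∈ T.edgeSet ∧ s(c, d) ∈ T.edgeSet} = numTreesAbove (⊥ ⊔ edge a b ⊔ edge c d) := by
    rw [numTreesAbove]
    congr 1
    ext T
    simp [spanningTrees, hi, hj]
  rw [hcard, hN, ← mul_add]
  congr 1
  rw [labelWeight_id, labelCard_id, labelCard_id, one_mul, mul_one] at hw1
  rw [hw1, labelCard_mergeLabel_id hi, labelCard_mergeLabel_id hi] at hw2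
  have hint : #{x | x ∈ s(a, b) ∧ x ∈ s(c, d)} =
      (if c = a ∨ c = b then 1 else 0) + (if d = a ∨ d = b then 1 else 0) := by
    have : ({x | x ∈ s(a, b) ∧ x ∈ s(c, d)} : Finset V) =
        {x ∈ ({c, d} : Finset V) | x = a ∨ x = b} := by
      ext x
      simp [and_comm]
    rw [this, card_filter, sum_pair hj]
  rw [hint]
  -- Distinct edges share at most one vertex, leaving weight `2 · 2 = 4` or `3`.
  have hnot : ¬((c = a ∨ c = b) ∧ (d = a ∨ d = b)) := by
    simp only [ne_eq, Sym2.eq_iff] at hij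
    grind
  split_ifs at hw2 ⊢ <;> omega

/-- The edge-vertex incidence matrix of the complete graph. -/
def topIncidence (V : Type*) : Matrix (⊤ : SimpleGraph V).edgeSet V ℝ :=
  Matrix.of fun e x => if x ∈ e.1 then 1 else 0

lemma topIncidence_mul_transpose_apply (i j : (⊤ : SimpleGraph V).edgeSet) :
    (topIncidence V * (topIncidence V).transpose) i j = #{x | x ∈ i.1 ∧ x ∈ j.1} := by
  simp [Matrix.mul_apply, topIncidence, ← ite_and, sum_boole, and_comm]

lemma card_mem_edge (i : (⊤ : SimpleGraph V).edgeSet) : #{x | x ∈ i.1} = 2 := by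
  obtain ⟨i, hi⟩ := i
  induction i with | _ a b
  have hab : a ≠ b := by simpa using hi
  rw [← card_pair hab]
  congr 1
  ext x
  simp

/-- The term `2` cancels the diagonal: `4 - 2 - 2 = 0`. The exponent is an integer because `n - 4`
is negative for `n = 3`. -/
lemma hessianMatrixAtOne_top_apply (hV : 2 ≤ Fintype.card V)
    (i j : (⊤ : SimpleGraph V).edgeSet) :
    (⊤ : SimpleGraph V).hessianMatrixAtOne ℝ i j =
      (Fintype.card V : ℝ) ^ ((Fintype.card V : ℤ) - 4) *
        (4 - (if i = j then 2 else 0) - (topIncidence V * (topIncidence V).transpose) i j) := by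
  rw [hessianMatrixAtOne_apply, topIncidence_mul_transpose_apply]
  split_ifs with hij
  · subst hij
    simp only [and_self, card_mem_edge]
    norm_num
  · have hd : ∀ e : (⊤ : SimpleGraph V).edgeSet, ¬e.1.IsDiag :=
      fun e => not_isDiag_of_mem_edgeSet _ e.2
    have h := card_spanningTrees_top_two_edges (hd i) (hd j) (fun h => hij (Subtype.ext h))
    have h' := congrArg (Nat.cast (R := ℝ)) h
    push_cast at h'
    have hn : (Fintype.card V : ℝ) ≠ 0 := by
      have : Fintype.card V ≠ 0 := by omega
      exact_mod_cast this
    have hp : (Fintype.card V : ℝ) ^ (Fintype.card V - 2) =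
        (Fintype.card V : ℝ) ^ ((Fintype.card V : ℤ) - 4) * (Fintype.card V : ℝ) ^ 2 := by
      rw [← zpow_natCast, ← zpow_natCast, ← zpow_add₀ hn]
      congr 1
      omega
    rw [hp] at h'
    apply mul_right_cancel₀ (pow_ne_zero 2 hn)
    linear_combination h'

end

end SimpleGraph

/-! ### Eigenspaces of `c(4J - 2I - MMᵀ)` -/

lemma Multiset.card_filter_replicate {α : Type*} (p : α → Prop) [DecidablePred p] (n : ℕ) (a : α) :
    Multiset.card ((Multiset.replicate n a).filter p) = if p a then n else 0 := by
  induction n with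
  | zero => simp
  | succ n ih =>
    rw [Multiset.replicate_succ, Multiset.filter_cons]
    split_ifs at ih ⊢ <;> simp [ih, add_comm]

namespace Matrix

open Finset _root_.Module

lemma sum_transpose_mulVec {E V : Type*} [Fintype E] [Fintype V] {M : Matrix E V ℝ}
    (hrow : ∀ e, ∑ v, M e v = 2) (x : E → ℝ) : ∑ v, (Mᵀ *ᵥ x) v = 2 * ∑ e, x e := by
  simp only [mulVec, dotProduct, transpose_apply]
  rw [sum_comm, mul_sum]
  exact sum_congr rfl fun e _ => by rw [← sum_mul, hrow]

section

variable {E V : Type*} [Fintype E] [Fintype V]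
  {M : Matrix E V ℝ} {H : Matrix E E ℝ} {c : ℝ}

lemma mulVec_eq_of_incidence [DecidableEq E]
    (hH : ∀ i j, H i j = c * (4 - (if i = j then 2 else 0) - (M * Mᵀ) i j)) (x : E → ℝ) (i : E) :
    (H *ᵥ x) i = c * (4 * (∑ e, x e) - 2 * x i - (M *ᵥ (Mᵀ *ᵥ x)) i) := by
  rw [mulVec_mulVec]
  simp only [mulVec, dotProduct, hH, mul_sub, sub_mul, sum_sub_distrib, mul_ite, ite_mul, mul_zero,
    zero_mul, sum_ite_eq, mem_univ, if_true, mul_sum, mul_assoc]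

lemma transpose_mulVec_mulVec [DecidableEq V]
    (hG : ∀ x y, (Mᵀ * M) x y = (if x = y then (Fintype.card V : ℝ) - 2 else 0) + 1)
    (y : V → ℝ) (v : V) :
    (Mᵀ *ᵥ (M *ᵥ y)) v = (Fintype.card V - 2) * y v + ∑ w, y w := by
  rw [mulVec_mulVec]
  simp only [mulVec, dotProduct, hG, add_mul, one_mul, sum_add_distrib, ite_mul, zero_mul,
    sum_ite_eq, mem_univ, if_true]

/-- On the kernel of `Mᵀ` the coordinate sum vanishes too, by `sum_transpose_mulVec`, so only `-2cI`
acts; rank-nullity bounds the dimension. -/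
lemma card_sub_le_finrank_eigenspace [DecidableEq E]
    (hrow : ∀ e, ∑ v, M e v = 2)
    (hH : ∀ i j, H i j = c * (4 - (if i = j then 2 else 0) - (M * Mᵀ) i j)) :
    Fintype.card E - Fintype.card V ≤ finrank ℝ (End.eigenspace (toLin' H) (-2 * c)) := by
  have hle : LinearMap.ker (toLin' Mᵀ) ≤ End.eigenspace (toLin' H) (-2 * c) := by
    intro x hx
    rw [LinearMap.mem_ker, toLin'_apply] at hx
    rw [End.mem_eigenspace_iff, toLin'_apply]
    have hs := sum_transpose_mulVec hrow x
    rw [hx] at hs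
    simp only [Pi.zero_apply, sum_const_zero] at hs
    ext i
    rw [mulVec_eq_of_incidence hH, hx, mulVec_zero, Pi.zero_apply, Pi.smul_apply, smul_eq_mul]
    linear_combination (-2 * c) * hs
  refine le_trans ?_ (Submodule.finrank_mono hle)
  have h1 := (toLin' Mᵀ).finrank_range_add_finrank_ker
  have h2 := (LinearMap.range (toLin' Mᵀ)).finrank_le
  rw [finrank_fintype_fun_eq_card] at h1 h2
  omega

/-- For `y` of sum zero, `MᵀMy = (n - 2)y`. Hence `M` is injective on such `y`, and `H` acts on `My`
as `c(-2 - (n - 2)) = -cn`. -/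
lemma card_sub_one_le_finrank_eigenspace [DecidableEq E] [DecidableEq V]
    (hrow : ∀ e, ∑ v, M e v = 2)
    (hG : ∀ x y, (Mᵀ * M) x y = (if x = y then (Fintype.card V : ℝ) - 2 else 0) + 1)
    (hH : ∀ i j, H i j = c * (4 - (if i = j then 2 else 0) - (M * Mᵀ) i j))
    (hV : 3 ≤ Fintype.card V) :
    Fintype.card V - 1 ≤
      finrank ℝ (End.eigenspace (toLin' H) (-(c * Fintype.card V))) := by
  let S : (V → ℝ) →ₗ[ℝ] ℝ := ∑ v, LinearMap.proj v
  have hS : ∀ y, S y = ∑ v, y v := fun y => by simp [S]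
  have hM : ∀ y ∈ LinearMap.ker S, ∀ v, (Mᵀ *ᵥ (M *ᵥ y)) v = (Fintype.card V - 2) * y v := by
    intro y hy v
    rw [LinearMap.mem_ker, hS] at hy
    rw [transpose_mulVec_mulVec hG, hy, add_zero]
  have hinj : Function.Injective ((toLin' M).domRestrict (LinearMap.ker S)) := by
    rw [← LinearMap.ker_eq_bot, LinearMap.ker_eq_bot']
    rintro ⟨y, hy⟩ h0
    rw [LinearMap.domRestrict_apply, toLin'_apply] at h0
    have hn : (Fintype.card V : ℝ) - 2 ≠ 0 := by
      have : (3 : ℝ) ≤ Fintype.card V := by exact_mod_cast hV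
      linarith
    ext v
    have h1 := hM y hy v
    change M *ᵥ y = 0 at h0
    rw [h0, mulVec_zero, Pi.zero_apply] at h1
    exact (mul_eq_zero.1 h1.symm).resolve_left hn
  have hle : LinearMap.range ((toLin' M).domRestrict (LinearMap.ker S)) ≤
      End.eigenspace (toLin' H) (-(c * Fintype.card V)) := by
    rintro _ ⟨⟨y, hy⟩, rfl⟩
    rw [LinearMap.domRestrict_apply, End.mem_eigenspace_iff, toLin'_apply, toLin'_apply]
    change H *ᵥ (M *ᵥ y) = _ • (M *ᵥ y)
    have hfun : Mᵀ *ᵥ (M *ᵥ y) = ((Fintype.card V : ℝ) - 2) • y := funext (hM y hy)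
    have hs := sum_transpose_mulVec hrow (M *ᵥ y)
    rw [LinearMap.mem_ker, hS] at hy
    simp only [hfun, Pi.smul_apply, smul_eq_mul, ← mul_sum, hy, mul_zero] at hs
    ext i
    rw [mulVec_eq_of_incidence hH, hfun, mulVec_smul, Pi.smul_apply, Pi.smul_apply, smul_eq_mul,
      smul_eq_mul]
    linear_combination (-2 * c) * hs
  refine le_trans ?_ (Submodule.finrank_mono hle)
  rw [LinearMap.finrank_range_of_inj hinj]
  have h1 := S.finrank_range_add_finrank_ker
  have h2 := (LinearMap.range S).finrank_le
  rw [finrank_fintype_fun_eq_card] at h1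
  rw [finrank_self] at h2
  omega

lemma one_le_finrank_eigenspace [DecidableEq E] [DecidableEq V] [Nonempty E]
    (hrow : ∀ e, ∑ v, M e v = 2)
    (hG : ∀ x y, (Mᵀ * M) x y = (if x = y then (Fintype.card V : ℝ) - 2 else 0) + 1)
    (hH : ∀ i j, H i j = c * (4 - (if i = j then 2 else 0) - (M * Mᵀ) i j)) :
    1 ≤ finrank ℝ (End.eigenspace (toLin' H)
      (2 * ((Fintype.card V : ℝ) - 2) * (c * Fintype.card V))) := by
  -- Writing the constant vector as an image of `M` lets the formula for `MᵀM` give the vertex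
  -- degrees `n - 1`.
  have hM : M *ᵥ (fun _ => (2 : ℝ)⁻¹) = fun _ => 1 := by
    ext e
    simp only [mulVec, dotProduct, ← sum_mul, hrow]
    norm_num
  have hMt : Mᵀ *ᵥ (fun _ => (1 : ℝ)) = fun _ => (Fintype.card V : ℝ) - 1 := by
    ext v
    rw [← hM, transpose_mulVec_mulVec hG, sum_const, card_univ, nsmul_eq_mul]
    ring
  have hs := sum_transpose_mulVec hrow (fun _ => (1 : ℝ))
  simp only [hMt, sum_const, card_univ, nsmul_eq_mul, mul_one] at hs
  have hmem : (fun _ => (1 : ℝ)) ∈ End.eigenspace (toLin' H)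
      (2 * ((Fintype.card V : ℝ) - 2) * (c * Fintype.card V)) := by
    rw [End.mem_eigenspace_iff, toLin'_apply]
    ext i
    rw [mulVec_eq_of_incidence hH, hMt]
    simp only [mulVec, dotProduct, ← sum_mul, hrow, sum_const, card_univ, nsmul_eq_mul, mul_one,
      Pi.smul_apply, smul_eq_mul]
    linear_combination (-2 * c) * hs
  rw [Submodule.one_le_finrank_iff]
  intro h
  rw [h, Submodule.mem_bot] at hmem
  exact one_ne_zero (congrFun hmem (Classical.arbitrary E))

end

lemma hasEigenvalue_toLin'_iff_mem_roots {E : Type*} [Fintype E] [DecidableEq E]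
    (H : Matrix E E ℝ) (μ : ℝ) : End.HasEigenvalue (toLin' H) μ ↔ μ ∈ H.charpoly.roots := by
  rw [End.hasEigenvalue_iff_isRoot_charpoly, charpoly_toLin',
    Polynomial.mem_roots H.charpoly_monic.ne_zero]

lemma finrank_eigenspace_le_count_roots {E : Type*} [Fintype E] [DecidableEq E]
    (H : Matrix E E ℝ) (μ : ℝ) :
    finrank ℝ (End.eigenspace (toLin' H) μ) ≤ H.charpoly.roots.count μ := by
  rw [Polynomial.count_roots, ← charpoly_toLin']
  exact LinearMap.finrank_eigenspace_le _ _

/-- If lower bounds on the dimensions of three eigenspaces add up to the size of the matrix, they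
determine the roots of the characteristic polynomial. -/
lemma roots_charpoly_eq_of_le_finrank {E : Type*} [Fintype E] [DecidableEq E] {H : Matrix E E ℝ}
    {μ₁ μ₂ μ₃ : ℝ} {d₁ d₂ d₃ : ℕ} (h₁₂ : μ₁ ≠ μ₂) (h₁₃ : μ₁ ≠ μ₃) (h₂₃ : μ₂ ≠ μ₃)
    (h₁ : d₁ ≤ finrank ℝ (End.eigenspace (toLin' H) μ₁))
    (h₂ : d₂ ≤ finrank ℝ (End.eigenspace (toLin' H) μ₂))
    (h₃ : d₃ ≤ finrank ℝ (End.eigenspace (toLin' H) μ₃)) (hd : d₁ + d₂ + d₃ = Fintype.card E) :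
    H.charpoly.roots =
      Multiset.replicate d₁ μ₁ + Multiset.replicate d₂ μ₂ + Multiset.replicate d₃ μ₃ := by
  symm
  -- Geometric multiplicity is at most algebraic multiplicity, and the degree leaves no room for
  -- further roots.
  refine Multiset.eq_of_le_of_card_le ?_ ?_
  · rw [Multiset.le_iff_count]
    intro μ
    simp only [Multiset.count_add, Multiset.count_replicate]
    have := H.finrank_eigenspace_le_count_roots μ
    split_ifs <;> subst_vars <;> first | omega | contradiction
  · refine (Polynomial.card_roots' _).trans ?_
    rw [charpoly_natDegree_eq_dim]
    simp [hd]

end Matrix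

/-! ### Incidence matrix of the complete graph -/

namespace SimpleGraph

open Finset

variable {V : Type*} [Fintype V]

lemma sum_topIncidence_apply (e : (⊤ : SimpleGraph V).edgeSet) :
    ∑ v, topIncidence V e v = 2 := by
  classical
  have h := card_mem_edge e
  simp only [topIncidence, Matrix.of_apply, sum_boole]
  exact_mod_cast h

lemma topIncidence_transpose_mul_apply [DecidableEq V] [Fintype (⊤ : SimpleGraph V).edgeSet]
    (x y : V) :
    ((topIncidence V).transpose * topIncidence V) x y =
      (if x = y then (Fintype.card V : ℝ) - 2 else 0) + 1 := by
  have hinc : ∀ e : (⊤ : SimpleGraph V).edgeSet, ∀ v,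
      topIncidence V e v = (⊤ : SimpleGraph V).incMatrix ℝ v e.1 := by
    intro e v
    simp only [topIncidence, Matrix.of_apply, incMatrix_apply', incidenceSet, Set.mem_ofPred_eq,
      e.2, true_and]
    congr
  have h1 : ((topIncidence V).transpose * topIncidence V) x y =
      ((⊤ : SimpleGraph V).incMatrix ℝ * ((⊤ : SimpleGraph V).incMatrix ℝ).transpose) x y := by
    simp only [Matrix.mul_apply, Matrix.transpose_apply, hinc]
    rw [← sum_subtype (s := (⊤ : SimpleGraph V).edgeFinset) (fun e => mem_edgeFinset)
      (fun e => (⊤ : SimpleGraph V).incMatrix ℝ x e * (⊤ : SimpleGraph V).incMatrix ℝ y e)]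
    -- `incMatrix` has a column for every element of `Sym2 V`; those of non-edges vanish.
    refine sum_subset (subset_univ _) fun e _ he => ?_
    rw [incMatrix_of_notMem_incidenceSet, zero_mul]
    exact fun h => he (mem_edgeFinset.2 h.1)
  rw [h1, incMatrix_mul_transpose]
  by_cases hxy : x = y
  · subst hxy
    have : 1 ≤ Fintype.card V := Fintype.card_pos_iff.2 ⟨x⟩
    simp [Nat.cast_sub this]
    ring
  · simp [hxy]

end SimpleGraph

/-! ### Spectrum and signature -/

theorem mainTheorem1 (n : ℕ) (hn : 3 ≤ n)
    (H : Matrix (⊤ : SimpleGraph (Fin n)).edgeSet (⊤ : SimpleGraph (Fin n)).edgeSet ℝ)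
    (hH : H = (⊤ : SimpleGraph (Fin n)).hessianMatrixAtOne ℝ) :
    -- the list of eigenvalues; the first one has multiplicity `0` for `n = 3`
    (∀ μ : ℝ, Module.End.HasEigenvalue (Matrix.toLin' H) μ ↔
      (4 ≤ n ∧ μ = -2 * (n : ℝ) ^ ((n : ℤ) - 4)) ∨
        μ = -(n : ℝ) ^ ((n : ℤ) - 3) ∨
        μ = 2 * ((n : ℝ) - 2) * (n : ℝ) ^ ((n : ℤ) - 3)) ∧
    -- the dimensions of the eigenspaces
    Module.finrank ℝ (Module.End.eigenspace (Matrix.toLin' H)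
      (-2 * (n : ℝ) ^ ((n : ℤ) - 4))) = n.choose 2 - n ∧
    Module.finrank ℝ (Module.End.eigenspace (Matrix.toLin' H)
      (-(n : ℝ) ^ ((n : ℤ) - 3))) = n - 1 ∧
    Module.finrank ℝ (Module.End.eigenspace (Matrix.toLin' H)
      (2 * ((n : ℝ) - 2) * (n : ℝ) ^ ((n : ℤ) - 3))) = 1 ∧
    -- `H` is symmetric and has Lorentzian signature: of its `n.choose 2` eigenvalues, counted with
    -- multiplicity, one is positive and the others are negative
    H.IsSymm ∧
    Multiset.card H.charpoly.roots = n.choose 2 ∧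
    Multiset.card (H.charpoly.roots.filter (fun μ : ℝ => 0 < μ)) = 1 ∧
    Multiset.card (H.charpoly.roots.filter (fun μ : ℝ => μ < 0)) = n.choose 2 - 1 := by
  have hn' : (3 : ℝ) ≤ n := by exact_mod_cast hn
  have hn0 : (n : ℝ) ≠ 0 := by positivity
  have hpow : (n : ℝ) ^ ((n : ℤ) - 3) = (n : ℝ) ^ ((n : ℤ) - 4) * n := by
    rw [← zpow_add_one₀ hn0]
    congr 1
    ring
  have hc : 0 < (n : ℝ) ^ ((n : ℤ) - 4) := zpow_pos (by positivity) _
  rw [hpow]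
  set c := (n : ℝ) ^ ((n : ℤ) - 4) with hcdef
  have hentry : ∀ i j, H i j = c * (4 - (if i = j then 2 else 0) -
      (SimpleGraph.topIncidence (Fin n) * (SimpleGraph.topIncidence (Fin n)).transpose) i j) := by
    intro i j
    rw [hH, SimpleGraph.hessianMatrixAtOne_top_apply (by simp; omega), Fintype.card_fin]
    congr
  have hrow := SimpleGraph.sum_topIncidence_apply (V := Fin n)
  have hG := SimpleGraph.topIncidence_transpose_mul_apply (V := Fin n)
  have hcard : Fintype.card (⊤ : SimpleGraph (Fin n)).edgeSet = n.choose 2 := by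
    rw [← SimpleGraph.edgeFinset_card, SimpleGraph.card_edgeFinset_top_eq_card_choose_two,
      Fintype.card_fin]
  have hchoose : n ≤ n.choose 2 := by
    rw [Nat.choose_two_right, Nat.le_div_iff_mul_le two_pos]
    exact Nat.mul_le_mul_left n (by omega)
  have : Nonempty (⊤ : SimpleGraph (Fin n)).edgeSet := by
    rw [← Fintype.card_pos_iff, hcard]
    omega
  have h₁ := Matrix.card_sub_le_finrank_eigenspace hrow hentry
  have h₂ := Matrix.card_sub_one_le_finrank_eigenspace hrow hG hentry (by simpa using hn)
  have h₃ := Matrix.one_le_finrank_eigenspace hrow hG hentry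
  rw [Fintype.card_fin] at h₁ h₂ h₃
  rw [hcard] at h₁
  set μ₁ := -2 * c with hμ₁
  set μ₂ := -(c * n) with hμ₂
  set μ₃ := 2 * ((n : ℝ) - 2) * (c * n) with hμ₃
  have hneg₁ : μ₁ < 0 := by linarith
  have hneg₂ : μ₂ < 0 := neg_lt_zero.2 (by positivity)
  have hpos₃ : 0 < μ₃ := mul_pos (by linarith) (by positivity)
  -- The difference is `c(n - 2)`, positive since `n ≥ 3`.
  have h₁₂ : μ₁ ≠ μ₂ := by
    have : 0 < c * (n - 2) := mul_pos hc (by linarith)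
    intro h
    linarith
  have h₁₃ : μ₁ ≠ μ₃ := (hneg₁.trans hpos₃).ne
  have h₂₃ : μ₂ ≠ μ₃ := (hneg₂.trans hpos₃).ne
  have hroots := Matrix.roots_charpoly_eq_of_le_finrank h₁₂ h₁₃ h₂₃ h₁ h₂ h₃ (by omega)
  have hle₁ := H.finrank_eigenspace_le_count_roots μ₁
  have hle₂ := H.finrank_eigenspace_le_count_roots μ₂
  have hle₃ := H.finrank_eigenspace_le_count_roots μ₃
  -- With the roots known, algebraic multiplicities bound the eigenspace dimensions from above.
  rw [hroots] at hle₁ hle₂ hle₃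
  simp only [Multiset.count_add, Multiset.count_replicate, h₁₂, h₁₂.symm, h₁₃, h₁₃.symm, h₂₃,
    h₂₃.symm, if_true, if_false, add_zero, zero_add] at hle₁ hle₂ hle₃
  refine ⟨fun μ => ?_, le_antisymm hle₁ h₁, le_antisymm hle₂ h₂, le_antisymm hle₃ h₃, ?_, ?_, ?_,
    ?_⟩
  · have hiff : n.choose 2 - n ≠ 0 ↔ 4 ≤ n := by
      rw [← Nat.pos_iff_ne_zero, Nat.sub_pos_iff_lt, Nat.choose_two_right]
      constructor
      · intro h
        by_contra h4
        obtain rfl : n = 3 := by omega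
        simp at h
      · intro h4
        have : n * 3 ≤ n * (n - 1) := Nat.mul_le_mul_left n (by omega)
        omega
    rw [Matrix.hasEigenvalue_toLin'_iff_mem_roots, hroots]
    simp only [Multiset.mem_add, Multiset.mem_replicate, hiff, or_assoc, one_ne_zero, ne_eq,
      not_false_eq_true, true_and, show n - 1 ≠ 0 by omega]
  · ext i j
    have hT : (SimpleGraph.topIncidence (Fin n) * (SimpleGraph.topIncidence (Fin n)).transpose) j i =
        (SimpleGraph.topIncidence (Fin n) * (SimpleGraph.topIncidence (Fin n)).transpose) i j := by
      simp only [Matrix.mul_apply, Matrix.transpose_apply, mul_comm]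
    rw [Matrix.transpose_apply, hentry, hentry, hT]
    simp only [eq_comm]
  · rw [hroots]
    simp
    omega
  · rw [hroots]
    simp only [Multiset.filter_add, Multiset.card_add, Multiset.card_filter_replicate, hneg₁.le.not_gt, hneg₂.le.not_gt,
      hpos₃, if_true, if_false, add_zero, zero_add]
  · rw [hroots]
    simp only [Multiset.filter_add, Multiset.card_add, Multiset.card_filter_replicate, hneg₁, hneg₂,
      hpos₃.le.not_gt, if_true, if_false, add_zero]
    omega
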